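/- Let $S=(V,E,T)$ be a connected triangulated surface: $V\subset\mathbb R^3$ is a finite set of vertices, $E$ a set of edges between vertices, and $T$ a set of non-degenerate triangles whose vertices lie in $V$ and whose sides are edges; every vertex and every edge belongs to some triangle, and any two vertices are joined by a path of edges. For $f\in T$ let $|f|>0$ be its area; for $v\in V$ let $T_v$ be the set of triangles with vertex $v$ and $|v|=\frac13\sum_{f\in T_v}|f|$. For $\varphi\in\mathbb R^V$ let $(G\varphi)_f$ be the gradient on $f$ of the affine function on $f$ that coincides with $\varphi$ at the vertices of $f$. Let $$\mathcal P(S)=\Big\{\mu\in\mathbb R^{V}\;:\;\mu_v\ge 0 \text{ for all } v\in V,\ \sum_{v\in V}|v|\mu_v=1\Big\}.$$ For $\bar\mu^0,\bar\mu^1\in\mathcal P(S)$ define $W_d(\bar\mu^0,\bar\mu^1)\ge 0$ by $$W_d^2(\bar\mu^0,\bar\mu^1)=\sup_{\varphi}\ \sum_{v\in V}|v|\,\varphi^1_v\,\bar\mu^1_v-\sum_{v\in V}|v|\,\varphi^0_v\,\bar\mu^0_v ,$$ where the supremum is over all $\varphi:[0,1]\times V\to\mathbb R$, $(t,v)\mapsto\varphi^t_v$,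 that are differentiable in $t$ on $[0,1]$ (one-sidedly at $t=0,1$) and satisfy $$\partial_t\varphi^t_v+\frac12\,\frac{\sum_{f\in T_v}|f|\,\|(G\varphi^t)_f\|^2}{3|v|}\le 0\qquad\text{for all }(t,v)\in[0,1]\times V.$$ Then $W_d$ is a distance on $\mathcal P(S)$: the supremum is always finite (and non-negative), and for all $\mu,\nu,\rho\in\mathcal P(S)$ one has $W_d(\mu,\nu)=0$ if and only if $\mu=\nu$, $W_d(\mu,\nu)=W_d(\nu,\mu)$, and $W_d(\mu,\rho)\le W_d(\mu,\nu)+W_d(\nu,\rho)$. -/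

import Mathlib

noncomputable section

/-- A triangulated surface `S = (V, E, T)` in `ℝ³`, possibly with boundary. -/
structure TriangulatedSurface where
  /-- the finite set of vertices, which are points of `ℝ³` -/
  V : Finset (EuclideanSpace ℝ (Fin 3))
  /-- the set of edges, as a simple graph on the vertices -/
  E : SimpleGraph V
  /-- the triangles; each is listed once, by an enumeration of its three vertices -/
  T : Finset (Fin 3 → V)
  /-- no triangle is listed twice -/
  triangle_ext : ∀ f ∈ T, ∀ g ∈ T, Set.range f = Set.range g → f = g
  /-- no triangle is degenerate -/
  affineIndependent : ∀ f ∈ T, AffineIndependent ℝ (fun i => (f i : EuclideanSpace ℝ (Fin 3)))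
  /-- the three vertices of a triangle are linked by edges -/
  adj_of_triangle : ∀ f ∈ T, ∀ i j, i ≠ j → E.Adj (f i) (f j)
  /-- every vertex is a vertex of some triangle -/
  vertex_mem_triangle : ∀ v, ∃ f ∈ T, v ∈ Set.range f
  /-- every edge is a side of some triangle -/
  edge_mem_triangle : ∀ v w, E.Adj v w → ∃ f ∈ T, v ∈ Set.range f ∧ w ∈ Set.range f

namespace TriangulatedSurface

/-- For affinely independent points `p i` of a Euclidean space and values `a i`, there is exactly
one vector `g`, parallel to the affine span of the points, such that the affine function
`x ↦ a i + ⟪g, x - p i⟫` takes the value `a j` at `p j`, for all `i`, `j`. -/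
theorem existsUnique_gradient {n : ℕ} (p : Fin (n + 1) → EuclideanSpace ℝ (Fin 3))
    (hp : AffineIndependent ℝ p) (a : Fin (n + 1) → ℝ) :
    ∃! g : EuclideanSpace ℝ (Fin 3), g ∈ vectorSpan ℝ (Set.range p) ∧
      ∀ i j, inner ℝ g (p j - p i) = a j - a i := by
  have hli := (affineIndependent_iff_linearIndependent_vsub ℝ p 0).1 hp
  have hspan : vectorSpan ℝ (Set.range p) =
      Submodule.span ℝ (Set.range fun i : {x : Fin (n + 1) // x ≠ 0} => p i -ᵥ p 0) := by
    rw [vectorSpan_range_eq_span_range_vsub_right_ne ℝ p 0]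
  rw [hspan]
  set U := Submodule.span ℝ (Set.range fun i : {x : Fin (n + 1) // x ≠ 0} => p i -ᵥ p 0) with hU
  let b := Module.Basis.span hli
  let L : U →ₗ[ℝ] ℝ := b.constr ℝ (fun i => a i - a 0)
  let g : U := (InnerProductSpace.toDual ℝ U).symm (LinearMap.toContinuousLinearMap L)
  have hg0 : ∀ i, inner ℝ (g : EuclideanSpace ℝ (Fin 3)) (p i - p 0) = a i - a 0 := by
    intro i
    by_cases hi : i = 0
    · subst hi; simp
    · have h1 : (inner ℝ g (b ⟨i, hi⟩) : ℝ) = L (b ⟨i, hi⟩) := by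
        simp [g]
      have h2 : L (b ⟨i, hi⟩) = a i - a 0 := by
        simp [L]
      have h3 : ((b ⟨i, hi⟩ : U) : EuclideanSpace ℝ (Fin 3)) = p i - p 0 := by
        simp [b, Module.Basis.span_apply]
      rw [← h2, ← h1, ← h3]
      rfl
  refine ⟨g, ⟨g.2, fun i j => ?_⟩, ?_⟩
  · have : p j - p i = (p j - p 0) - (p i - p 0) := by abel
    rw [this, inner_sub_right, hg0, hg0]
    ring
  · rintro g' ⟨hg'U, hg'⟩
    have hd : g' - g ∈ U := U.sub_mem hg'U g.2
    have horth : ∀ x ∈ U, inner ℝ (g' - (g : EuclideanSpace ℝ (Fin 3))) x = 0 := by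
      intro x hx
      induction hx using Submodule.span_induction with
      | mem x hx =>
        obtain ⟨i, rfl⟩ := hx
        have := hg' 0 i
        change inner ℝ (g' - (g : EuclideanSpace ℝ (Fin 3))) (p i - p 0) = 0
        rw [inner_sub_left, this, hg0]
        ring
      | zero => simp
      | add x y _ _ hx hy => rw [inner_add_right, hx, hy, add_zero]
      | smul c x _ hx => rw [inner_smul_right, hx, mul_zero]
    exact sub_eq_zero.1 (inner_self_eq_zero.1 (horth _ hd))

variable (S : TriangulatedSurface)

/-- The `i`-th vertex of the triangle `f`, as a point of `ℝ³`. -/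
def point (f : S.T) (i : Fin 3) : EuclideanSpace ℝ (Fin 3) := (f.1 i : EuclideanSpace ℝ (Fin 3))

/-- The area `|f|` of a triangle `f`: half the product of two sides and the sine of the angle
between them. -/
def area (f : S.T) : ℝ :=
  1 / 2 * dist (S.point f 0) (S.point f 1) * dist (S.point f 0) (S.point f 2) *
    Real.sin (EuclideanGeometry.angle (S.point f 1) (S.point f 0) (S.point f 2))

open Classical in
/-- The set `T_v` of the triangles that have `v` as a vertex. -/
def star (v : S.V) : Finset S.T := {f : S.T | v ∈ Set.range f.1}

/-- The area `|v|` of the barycentric dual cell of the vertex `v`. -/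
def dualArea (v : S.V) : ℝ := 1 / 3 * ∑ f ∈ S.star v, S.area f

/-- The gradient `(G φ)_f` on the triangle `f`: the gradient, in the plane of `f`, of the affine
function on `f` that coincides with `φ` on the vertices of `f`. -/
def gradient (φ : S.V → ℝ) (f : S.T) : EuclideanSpace ℝ (Fin 3) :=
  (existsUnique_gradient (S.point f) (S.affineIndependent f.1 f.2) (fun i => φ (f.1 i))).choose

/-- The set `P(S)` of the probability distributions on `S`, given by their densities. -/
def Prob : Type :=
  {μ : S.V → ℝ // (∀ v, 0 ≤ μ v) ∧ ∑ v, S.dualArea v * μ v = 1}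

/-- Admissibility of a potential `φ : [0,1] × V → ℝ` (values at times outside `[0,1]` play no
role): it is differentiable in time on `[0,1]` and satisfies the discrete Hamilton–Jacobi
inequality at every time in `[0,1]` and every vertex. -/
def Admissible (φ : ℝ → S.V → ℝ) : Prop :=
  ∀ t ∈ Set.Icc (0 : ℝ) 1, ∀ v : S.V,
    DifferentiableWithinAt ℝ (fun s => φ s v) (Set.Icc 0 1) t ∧
    derivWithin (fun s => φ s v) (Set.Icc 0 1) t +
      1 / 2 * ((∑ f ∈ S.star v, S.area f * ‖S.gradient (φ t) f‖ ^ 2) / (3 * S.dualArea v)) ≤ 0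

/-- The values of the objective at the admissible potentials; the squared discrete Wasserstein
distance is their supremum. -/
def dualValues (μ₀ μ₁ : S.Prob) : Set ℝ :=
  {c | ∃ φ : ℝ → S.V → ℝ, S.Admissible φ ∧
    c = ∑ v, S.dualArea v * φ 1 v * μ₁.1 v - ∑ v, S.dualArea v * φ 0 v * μ₀.1 v}

/-- The discrete quadratic Wasserstein distance `W_d`. -/
def Wd (μ₀ μ₁ : S.Prob) : ℝ := √(sSup (S.dualValues μ₀ μ₁))

end TriangulatedSurface

end

/-!
Write `H φ v` for the Hamiltonian, half the average of `‖∇φ‖²` over the triangles at `v`, so that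
admissibility reads `∂ₜ φ ≤ -H φ`. Since `H` is a quadratic form, `t ↦ l φ (a + l t)` is admissible
whenever `φ` is (`Admissible.rescale`). Consequently an admissible potential gains at most
`W_d² / l` on a time interval of signed length `l` (`Admissible.mul_integral_sub_le`). The interval
run backwards gives the symmetry. Splitting `[0, 1]` into intervals of lengths proportional to
`a = W_d(μ₀, μ₁)` and `b = W_d(μ₁, μ₂)` gives `W_d(μ₀, μ₂)² ≤ (a + b)²`, the triangle inequality.

Admissible potentials decrease in time, so `W_d(μ, μ) = 0`. If `μ₀ ≠ μ₁`, the potential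
`ε ψ - ε² C t` with `C ≥ H ψ` and `ψ` separating the two distributions has a positive value for
small `ε > 0`, so `W_d(μ₀, μ₁) > 0`.

The supremum is finite because the surface is connected: the energy `e = ∑ |v| H φ v` controls the
square of the oscillation of `φ` (`exists_abs_sub_le`). Along a path `m` of distributions from `μ₀`
to `μ₁`, the derivative of `∫ φ dm` is at most `∫ φ dm' - ∫ H φ dm`. The path is chosen such that,
for `s = t (1 - t)`, the density of `m` is at least a multiple of `s²` and that of `m'` is of order
`s`. The derivative is then at most `K s √e - c s² e ≤ K² / (4 c)` (`bddAbove_dualValues`).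
-/

namespace TriangulatedSurface

variable {S : TriangulatedSurface}

/-! ### Areas and gradients -/

theorem area_pos (f : S.T) : 0 < S.area f := by
  have hai : AffineIndependent ℝ (S.point f) := S.affineIndependent f.1 f.2
  have hne : ∀ i j, i ≠ j → 0 < dist (S.point f i) (S.point f j) := fun i j hij =>
    dist_pos.2 fun h => hij (hai.injective h)
  have hncol : ¬ Collinear ℝ {S.point f 1, S.point f 0, S.point f 2} := by
    rw [← affineIndependent_iff_not_collinear_set]
    have h : ![S.point f 1, S.point f 0, S.point f 2] =
        S.point f ∘ Equiv.swap (0 : Fin 3) 1 := by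
      funext i
      fin_cases i <;> rfl
    rw [h]
    exact (affineIndependent_equiv (Equiv.swap (0 : Fin 3) 1)).2 hai
  have hsin := EuclideanGeometry.sin_pos_of_not_collinear hncol
  have h1 := hne 0 1 (by decide)
  have h2 := hne 0 2 (by decide)
  unfold area
  positivity

theorem mem_star {v : S.V} {f : S.T} : f ∈ S.star v ↔ v ∈ Set.range f.1 := by
  simp [star]

theorem dualArea_pos (v : S.V) : 0 < S.dualArea v := by
  obtain ⟨f, hf, hv⟩ := S.vertex_mem_triangle v
  have : 0 < ∑ f ∈ S.star v, S.area f :=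
    Finset.sum_pos (fun f _ => area_pos f) ⟨⟨f, hf⟩, mem_star.2 hv⟩
  unfold dualArea
  positivity

theorem inner_gradient (φ : S.V → ℝ) (f : S.T) (i j : Fin 3) :
    inner ℝ (S.gradient φ f) (S.point f j - S.point f i) = φ (f.1 j) - φ (f.1 i) :=
  (existsUnique_gradient (S.point f) (S.affineIndependent f.1 f.2)
    (fun i => φ (f.1 i))).choose_spec.1.2 i j

theorem gradient_affine (φ : S.V → ℝ) (c d : ℝ) (f : S.T) :
    S.gradient (fun v => c * φ v + d) f = c • S.gradient φ f := by
  have h := (existsUnique_gradient (S.point f) (S.affineIndependent f.1 f.2)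
    (fun i => c * φ (f.1 i) + d)).choose_spec.2
  refine (h _ ⟨Submodule.smul_mem _ _ ?_, fun i j => ?_⟩).symm
  · exact (existsUnique_gradient (S.point f) (S.affineIndependent f.1 f.2)
      (fun i => φ (f.1 i))).choose_spec.1.1
  · rw [real_inner_smul_left, inner_gradient]
    ring

/-! ### The Hamiltonian and the energy -/

/-- The Hamiltonian at the vertex `v`: half the average of `‖∇φ‖²` over the triangles at `v`. -/
noncomputable def hamiltonian (φ : S.V → ℝ) (v : S.V) : ℝ :=
  1 / 2 * ((∑ f ∈ S.star v, S.area f * ‖S.gradient φ f‖ ^ 2) / (3 * S.dualArea v))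

theorem hamiltonian_nonneg (φ : S.V → ℝ) (v : S.V) : 0 ≤ hamiltonian φ v := by
  have h1 := dualArea_pos v
  have h2 : 0 ≤ ∑ f ∈ S.star v, S.area f * ‖S.gradient φ f‖ ^ 2 :=
    Finset.sum_nonneg fun f _ => mul_nonneg (area_pos f).le (sq_nonneg _)
  unfold hamiltonian
  positivity

theorem hamiltonian_affine (φ : S.V → ℝ) (c d : ℝ) (v : S.V) :
    hamiltonian (fun v => c * φ v + d) v = c ^ 2 * hamiltonian φ v := by
  have h : ∀ f, S.area f * ‖c • S.gradient φ f‖ ^ 2 =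
      c ^ 2 * (S.area f * ‖S.gradient φ f‖ ^ 2) := fun f => by
    rw [norm_smul, mul_pow, Real.norm_eq_abs, sq_abs]
    ring
  simp only [hamiltonian, gradient_affine, h, ← Finset.mul_sum]
  ring

/-- The total energy of `φ`, the integral of the Hamiltonian over the surface (equal to the
Dirichlet energy `1/2 ∑ |f| ‖∇φ‖²`). -/
noncomputable def energy (φ : S.V → ℝ) : ℝ := ∑ v, S.dualArea v * hamiltonian φ v

theorem energy_nonneg (φ : S.V → ℝ) : 0 ≤ energy φ :=
  Finset.sum_nonneg fun v _ => mul_nonneg (dualArea_pos v).le (hamiltonian_nonneg φ v)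

theorem area_mul_norm_gradient_sq_le (φ : S.V → ℝ) (f : S.T) :
    S.area f * ‖S.gradient φ f‖ ^ 2 ≤ 6 * energy φ := by
  have h1 : S.dualArea (f.1 0) * hamiltonian φ (f.1 0) ≤ energy φ :=
    Finset.single_le_sum (f := fun v => S.dualArea v * hamiltonian φ v)
      (fun v _ => mul_nonneg (dualArea_pos v).le (hamiltonian_nonneg φ v)) (Finset.mem_univ _)
  have h2 : S.area f * ‖S.gradient φ f‖ ^ 2 ≤
      ∑ g ∈ S.star (f.1 0), S.area g * ‖S.gradient φ g‖ ^ 2 :=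
    Finset.single_le_sum (f := fun g => S.area g * ‖S.gradient φ g‖ ^ 2)
      (fun g _ => mul_nonneg (area_pos g).le (sq_nonneg _)) (mem_star.2 ⟨0, rfl⟩)
  have h3 : S.dualArea (f.1 0) * hamiltonian φ (f.1 0) =
      1 / 6 * ∑ g ∈ S.star (f.1 0), S.area g * ‖S.gradient φ g‖ ^ 2 := by
    have := (dualArea_pos (f.1 0)).ne'
    unfold hamiltonian
    field_simp
    ring
  linarith

theorem exists_abs_sub_le_of_adj {v w : S.V} (h : S.E.Adj v w) :
    ∃ C : ℝ, 0 ≤ C ∧ ∀ φ : S.V → ℝ, |φ v - φ w| ≤ C * √(energy φ) := by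
  obtain ⟨f, hf, ⟨i, hi⟩, ⟨j, hj⟩⟩ := S.edge_mem_triangle v w h
  have hA := area_pos (⟨f, hf⟩ : S.T)
  set A := S.area ⟨f, hf⟩
  set d := S.point ⟨f, hf⟩ i - S.point ⟨f, hf⟩ j
  refine ⟨√(6 / A) * ‖d‖, by positivity, fun φ => ?_⟩
  have h1 := inner_gradient φ ⟨f, hf⟩ j i
  have h2 : ‖S.gradient φ ⟨f, hf⟩‖ ≤ √(6 / A) * √(energy φ) := by
    rw [← Real.sqrt_mul (by positivity)]
    apply Real.le_sqrt_of_sq_le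
    rw [div_mul_eq_mul_div, le_div_iff₀ hA, mul_comm]
    exact area_mul_norm_gradient_sq_le φ _
  change inner ℝ _ d = φ (f i) - φ (f j) at h1
  rw [← hi, ← hj, ← h1]
  calc |inner ℝ (S.gradient φ ⟨f, hf⟩) d| ≤ ‖S.gradient φ ⟨f, hf⟩‖ * ‖d‖ :=
        abs_real_inner_le_norm _ _
    _ ≤ √(6 / A) * √(energy φ) * ‖d‖ := by gcongr
    _ = √(6 / A) * ‖d‖ * √(energy φ) := by ring

/-- A Poincaré inequality: on a connected surface the energy controls the oscillation, since
differences along edges are controlled and can be summed along a walk. -/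
theorem exists_abs_sub_le (hS : S.E.Connected) :
    ∃ C : ℝ, 0 ≤ C ∧ ∀ (φ : S.V → ℝ) (v w : S.V), |φ v - φ w| ≤ C * √(energy φ) := by
  have key : ∀ v w : S.V, ∃ C : ℝ, 0 ≤ C ∧ ∀ φ : S.V → ℝ, |φ v - φ w| ≤ C * √(energy φ) := by
    intro v w
    obtain ⟨p⟩ := hS.preconnected v w
    induction p with
    | nil => exact ⟨0, le_rfl, fun φ => by simp⟩
    | cons h _ ih =>
      obtain ⟨C₁, hC₁, h₁⟩ := exists_abs_sub_le_of_adj h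
      obtain ⟨C₂, hC₂, h₂⟩ := ih
      refine ⟨C₁ + C₂, by positivity, fun φ => ?_⟩
      rw [add_mul]
      exact (abs_sub_le _ _ _).trans (add_le_add (h₁ φ) (h₂ φ))
  choose C hC hφ using key
  refine ⟨∑ v, ∑ w, C v w, Finset.sum_nonneg fun v _ => Finset.sum_nonneg fun w _ => hC v w,
    fun φ v w => (hφ v w φ).trans ?_⟩
  gcongr
  exact (Finset.single_le_sum (fun w _ => hC v w) (Finset.mem_univ w)).trans
    (Finset.single_le_sum (f := fun v => ∑ w, C v w)
      (fun v _ => Finset.sum_nonneg fun w _ => hC v w) (Finset.mem_univ v))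

/-! ### Integration against densities -/

/-- The integral of `φ` against the density `μ`. -/
noncomputable def integral (μ φ : S.V → ℝ) : ℝ := ∑ v, S.dualArea v * φ v * μ v

theorem integral_mono {μ φ ψ : S.V → ℝ} (hμ : ∀ v, 0 ≤ μ v) (h : ∀ v, φ v ≤ ψ v) :
    integral μ φ ≤ integral μ ψ :=
  Finset.sum_le_sum fun v _ =>
    mul_le_mul_of_nonneg_right (mul_le_mul_of_nonneg_left (h v) (dualArea_pos v).le) (hμ v)

theorem integral_affine (μ : S.Prob) (φ : S.V → ℝ) (c d : ℝ) :
    integral μ.1 (fun v => c * φ v + d) = c * integral μ.1 φ + d := by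
  have h := congrArg (d * ·) μ.2.2
  simp only [mul_one, Finset.mul_sum] at h
  conv_rhs => rw [← h]
  simp only [integral, Finset.mul_sum, ← Finset.sum_add_distrib]
  exact Finset.sum_congr rfl fun v _ => by ring

theorem integral_sub_integral_le (μ ν : S.Prob) {φ : S.V → ℝ} {R : ℝ}
    (h : ∀ v w, φ v - φ w ≤ R) : integral μ.1 φ - integral ν.1 φ ≤ R := by
  have h1 : ∀ w, integral μ.1 φ ≤ φ w + R := fun w => by
    have := integral_mono (φ := φ) (ψ := fun v => 0 * φ v + (φ w + R)) μ.2.1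
      fun v => by linarith [h v w]
    rwa [integral_affine, zero_mul, zero_add] at this
  have h2 := integral_mono (φ := fun v => 0 * φ v + integral μ.1 φ)
    (ψ := fun v => 1 * φ v + R) ν.2.1 fun v => by linarith [h1 v]
  rw [integral_affine, integral_affine] at h2
  linarith

/-- The uniform probability distribution, whose density is constant. -/
noncomputable def uniform [Nonempty S.V] : S.Prob :=
  ⟨fun _ => (∑ v, S.dualArea v)⁻¹,
    fun _ => inv_nonneg.2 (Finset.sum_nonneg fun v _ => (dualArea_pos v).le), by
    rw [← Finset.sum_mul]
    exact mul_inv_cancel₀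
      (Finset.sum_pos (fun v _ => dualArea_pos v) Finset.univ_nonempty).ne'⟩

theorem integral_uniform_hamiltonian [Nonempty S.V] (φ : S.V → ℝ) :
    integral (uniform (S := S)).1 (hamiltonian φ) = energy φ / ∑ v, S.dualArea v := by
  simp only [integral, uniform, energy, div_eq_mul_inv, Finset.sum_mul]

theorem eq_of_forall_integral_eq {μ ν : S.Prob}
    (h : ∀ φ, integral ν.1 φ ≤ integral μ.1 φ) : μ = ν := by
  have h0 : ∑ v, S.dualArea v * (ν.1 v - μ.1 v) ^ 2 ≤ 0 := by
    have := h fun v => ν.1 v - μ.1 v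
    rw [← sub_nonpos] at this
    refine le_of_eq_of_le ?_ this
    simp only [integral, ← Finset.sum_sub_distrib]
    exact Finset.sum_congr rfl fun v _ => by ring
  have hnn : ∀ v ∈ Finset.univ, 0 ≤ S.dualArea v * (ν.1 v - μ.1 v) ^ 2 :=
    fun v _ => mul_nonneg (dualArea_pos v).le (sq_nonneg _)
  have h1 := (Finset.sum_eq_zero_iff_of_nonneg hnn).1 (h0.antisymm (Finset.sum_nonneg hnn))
  refine Subtype.ext (funext fun v => ?_)
  have h2 := h1 v (Finset.mem_univ v)
  rw [mul_eq_zero, or_iff_right (dualArea_pos v).ne', sq_eq_zero_iff] at h2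
  linarith

/-! ### Admissible potentials -/

theorem admissible_of_hasDerivWithinAt {φ φ' : ℝ → S.V → ℝ}
    (h : ∀ t ∈ Set.Icc (0 : ℝ) 1, ∀ v,
      HasDerivWithinAt (fun s => φ s v) (φ' t v) (Set.Icc 0 1) t ∧
        φ' t v + hamiltonian (φ t) v ≤ 0) :
    S.Admissible φ := by
  intro t ht v
  obtain ⟨hd, hle⟩ := h t ht v
  refine ⟨hd.differentiableWithinAt, ?_⟩
  rw [hd.derivWithin (uniqueDiffOn_Icc zero_lt_one t ht)]
  exact hle

theorem Admissible.exists_hasDerivWithinAt {φ : ℝ → S.V → ℝ} (h : S.Admissible φ) :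
    ∃ φ' : ℝ → S.V → ℝ, ∀ t ∈ Set.Icc (0 : ℝ) 1, ∀ v,
      HasDerivWithinAt (fun s => φ s v) (φ' t v) (Set.Icc 0 1) t ∧
        φ' t v + hamiltonian (φ t) v ≤ 0 :=
  ⟨fun t v => derivWithin (fun s => φ s v) (Set.Icc 0 1) t, fun t ht v =>
    ⟨(h t ht v).1.hasDerivWithinAt, (h t ht v).2⟩⟩

/-- Both sides of the Hamilton–Jacobi inequality are quadratic under the affine time change
`t ↦ a + l t` with amplitude `l`. For `l < 0` this reverses time. -/
theorem Admissible.rescale {φ : ℝ → S.V → ℝ} (h : S.Admissible φ) {a l : ℝ}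
    (ha : a ∈ Set.Icc (0 : ℝ) 1) (hal : a + l ∈ Set.Icc (0 : ℝ) 1) :
    S.Admissible (fun t v => l * φ (a + l * t) v) := by
  obtain ⟨φ', hφ'⟩ := h.exists_hasDerivWithinAt
  have hmaps : Set.MapsTo (fun t => a + l * t) (Set.Icc (0 : ℝ) 1) (Set.Icc 0 1) := by
    rintro t ⟨ht0, ht1⟩
    constructor <;> nlinarith [ha.1, ha.2, hal.1, hal.2]
  refine admissible_of_hasDerivWithinAt (φ' := fun t v => l ^ 2 * φ' (a + l * t) v)
    fun t ht v => ?_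
  obtain ⟨hd, hle⟩ := hφ' _ (hmaps ht) v
  constructor
  · have hlin : HasDerivWithinAt (fun t => a + l * t) l (Set.Icc (0 : ℝ) 1) t := by
      simpa using ((hasDerivAt_id t).const_mul l).const_add a |>.hasDerivWithinAt
    have := (hd.comp t hlin hmaps).const_mul l
    exact this.congr_deriv (by ring)
  · have := hamiltonian_affine (φ (a + l * t)) l 0 v
    simp only [add_zero] at this
    rw [this]
    nlinarith [sq_nonneg l]

theorem admissible_test (ψ : S.V → ℝ) {C : ℝ} (hC : ∀ v, hamiltonian ψ v ≤ C) (ε : ℝ) :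
    S.Admissible (fun t v => ε * ψ v + -(ε ^ 2 * C) * t) := by
  refine admissible_of_hasDerivWithinAt (φ' := fun _ _ => -(ε ^ 2 * C)) fun t _ v => ⟨?_, ?_⟩
  · simpa using (((hasDerivAt_id t).const_mul (-(ε ^ 2 * C))).const_add (ε * ψ v)).hasDerivWithinAt
  · rw [hamiltonian_affine]
    nlinarith [hC v, sq_nonneg ε]

theorem sub_le_of_hasDerivWithinAt_le {g g' : ℝ → ℝ} {K : ℝ}
    (hg : ∀ t ∈ Set.Icc (0 : ℝ) 1, HasDerivWithinAt g (g' t) (Set.Icc 0 1) t ∧ g' t ≤ K) :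
    g 1 - g 0 ≤ K := by
  have hd : ∀ t ∈ interior (Set.Icc (0 : ℝ) 1), HasDerivAt g (g' t) t := fun t ht =>
    (hg t (interior_subset ht)).1.hasDerivAt (mem_interior_iff_mem_nhds.1 ht)
  have := (convex_Icc (0 : ℝ) 1).image_sub_le_mul_sub_of_deriv_le (f := g) (C := K)
    (fun t ht => (hg t ht).1.continuousWithinAt)
    (fun t ht => (hd t ht).differentiableAt.differentiableWithinAt)
    (fun t ht => (hd t ht).deriv ▸ (hg t (interior_subset ht)).2)
    0 (by simp) 1 (by simp) zero_le_one
  simpa using this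

theorem Admissible.apply_one_le {φ : ℝ → S.V → ℝ} (h : S.Admissible φ) (v : S.V) :
    φ 1 v ≤ φ 0 v := by
  obtain ⟨φ', hφ'⟩ := h.exists_hasDerivWithinAt
  refine sub_nonpos.1 (sub_le_of_hasDerivWithinAt_le (g := fun t => φ t v)
    (g' := fun t => φ' t v) fun t ht => ⟨(hφ' t ht v).1, ?_⟩)
  linarith [(hφ' t ht v).2, hamiltonian_nonneg (φ t) v]

/-! ### Finiteness of the supremum -/

/-- The density at time `t` of a path of distributions from `μ₀` to `μ₁`: the cubic interpolation
`(1 - t)² (1 + 2t) μ₀ + t² (3 - 2t) μ₁`, plus `2 t² (1 - t)²` times the difference of the uniform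
distribution and the mean of `μ₀` and `μ₁`. The share of the uniform distribution is quadratic in
the distance to the endpoints `t = 0, 1`, and the speed of the path is linear in it. -/
noncomputable def path [Nonempty S.V] (μ₀ μ₁ : S.Prob) (t : ℝ) (v : S.V) : ℝ :=
  (1 - t) ^ 2 * (1 + 2 * t - t ^ 2) * μ₀.1 v + t ^ 2 * (2 - t ^ 2) * μ₁.1 v +
    2 * t ^ 2 * (1 - t) ^ 2 * (uniform (S := S)).1 v

/-- The time derivative of `path`. -/
noncomputable def pathDeriv [Nonempty S.V] (μ₀ μ₁ : S.Prob) (t : ℝ) (v : S.V) : ℝ :=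
  t * (1 - t) * (6 * (μ₁.1 v - μ₀.1 v) + 2 * (1 - 2 * t) *
    (((uniform (S := S)).1 v - μ₀.1 v) + ((uniform (S := S)).1 v - μ₁.1 v)))

theorem hasDerivAt_path [Nonempty S.V] (μ₀ μ₁ : S.Prob) (t : ℝ) (v : S.V) :
    HasDerivAt (fun s => path μ₀ μ₁ s v) (pathDeriv μ₀ μ₁ t v) t := by
  have h1 := hasDerivAt_id t
  have h2 := h1.const_sub 1
  have hA := (h2.pow 2).mul (((h1.const_mul 2).const_add 1).sub (h1.pow 2))
  have hB := (h1.pow 2).mul ((h1.pow 2).const_sub 2)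
  have hC := ((h1.pow 2).const_mul 2).mul (h2.pow 2)
  have := ((hA.mul_const (μ₀.1 v)).add (hB.mul_const (μ₁.1 v))).add
    (hC.mul_const ((uniform (S := S)).1 v))
  refine this.congr_deriv ?_
  simp only [pathDeriv, Pi.pow_apply, Pi.sub_apply, id, Nat.cast_ofNat]
  ring

theorem le_path [Nonempty S.V] (μ₀ μ₁ : S.Prob) {t : ℝ} (ht : t ∈ Set.Icc (0 : ℝ) 1) (v : S.V) :
    2 * t ^ 2 * (1 - t) ^ 2 * (uniform (S := S)).1 v ≤ path μ₀ μ₁ t v := by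
  have h0 : 0 ≤ 1 + 2 * t - t ^ 2 := by nlinarith [ht.1, ht.2]
  have h1 : 0 ≤ 2 - t ^ 2 := by nlinarith [ht.1, ht.2]
  have h2 := mul_nonneg (mul_nonneg (sq_nonneg (1 - t)) h0) (μ₀.2.1 v)
  have h3 := mul_nonneg (mul_nonneg (sq_nonneg t) h1) (μ₁.2.1 v)
  unfold path
  linarith

theorem integral_pathDeriv_le [Nonempty S.V] (μ₀ μ₁ : S.Prob) {t : ℝ}
    (ht : t ∈ Set.Icc (0 : ℝ) 1) {φ : S.V → ℝ} {R : ℝ} (h : ∀ v w, φ v - φ w ≤ R) :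
    integral (pathDeriv μ₀ μ₁ t) φ ≤ 10 * (t * (1 - t)) * R := by
  set u : S.Prob := uniform
  have heq : integral (pathDeriv μ₀ μ₁ t) φ = t * (1 - t) *
      (6 * (integral μ₁.1 φ - integral μ₀.1 φ) + 2 * (1 - 2 * t) *
        ((integral u.1 φ - integral μ₀.1 φ) + (integral u.1 φ - integral μ₁.1 φ))) := by
    simp only [integral, pathDeriv, ← Finset.sum_sub_distrib, ← Finset.sum_add_distrib,
      Finset.mul_sum]
    exact Finset.sum_congr rfl fun v _ => by ring
  have h1 := integral_sub_integral_le μ₁ μ₀ h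
  have h2 := integral_sub_integral_le u μ₀ h
  have h3 := integral_sub_integral_le u μ₁ h
  have h4 := integral_sub_integral_le μ₀ u h
  have h5 := integral_sub_integral_le μ₁ u h
  have h6 : (1 - 2 * t) * ((integral u.1 φ - integral μ₀.1 φ) +
      (integral u.1 φ - integral μ₁.1 φ)) ≤ 2 * R := by
    nlinarith [ht.1, ht.2]
  have h7 : 0 ≤ t * (1 - t) := mul_nonneg ht.1 (by linarith [ht.2])
  rw [heq]
  nlinarith

theorem bddAbove_dualValues (hS : S.E.Connected) (μ₀ μ₁ : S.Prob) :
    BddAbove (S.dualValues μ₀ μ₁) := by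
  obtain ⟨C, hC, hosc⟩ := exists_abs_sub_le hS
  have : Nonempty S.V := hS.nonempty
  set A := ∑ v, S.dualArea v with hA_def
  have hA : 0 < A := Finset.sum_pos (fun v _ => dualArea_pos v) Finset.univ_nonempty
  refine ⟨25 / 2 * C ^ 2 * A, ?_⟩
  rintro _ ⟨φ, hφ, rfl⟩
  obtain ⟨φ', hφ'⟩ := hφ.exists_hasDerivWithinAt
  have key := sub_le_of_hasDerivWithinAt_le (g := fun t => integral (path μ₀ μ₁ t) (φ t))
    (g' := fun t => integral (path μ₀ μ₁ t) (φ' t) + integral (pathDeriv μ₀ μ₁ t) (φ t))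
    (K := 25 / 2 * C ^ 2 * A) fun t ht => ⟨?_, ?_⟩
  · simpa [integral, path, show (2 : ℝ) - 1 = 1 by norm_num] using key
  · simp only [integral, ← Finset.sum_add_distrib]
    refine HasDerivWithinAt.fun_sum fun v _ => ?_
    exact ((hφ' t ht v).1.const_mul (S.dualArea v)).mul (hasDerivAt_path μ₀ μ₁ t v).hasDerivWithinAt
  · set e := energy (φ t)
    have he : √e ^ 2 = e := Real.sq_sqrt (energy_nonneg _)
    have h1 := integral_pathDeriv_le μ₀ μ₁ ht (φ := φ t) (R := C * √e)
      fun v w => (le_abs_self _).trans (hosc _ v w)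
    have h2 : integral (path μ₀ μ₁ t) (φ' t) ≤ -(2 * t ^ 2 * (1 - t) ^ 2 * (e / A)) := by
      rw [hA_def, ← integral_uniform_hamiltonian]
      simp only [integral, Finset.mul_sum, ← Finset.sum_neg_distrib]
      refine Finset.sum_le_sum fun v _ => ?_
      have h3 := hamiltonian_nonneg (φ t) v
      have h4 : 0 ≤ path μ₀ μ₁ t v := le_trans
        (mul_nonneg (by positivity) ((uniform (S := S)).2.1 v)) (le_path μ₀ μ₁ ht v)
      have h5 : φ' t v * path μ₀ μ₁ t v ≤ -hamiltonian (φ t) v * path μ₀ μ₁ t v :=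
        mul_le_mul_of_nonneg_right (by linarith [(hφ' t ht v).2]) h4
      have h6 := mul_le_mul_of_nonneg_left (le_path μ₀ μ₁ ht v) h3
      have h7 := mul_le_mul_of_nonneg_left (h5.trans (by linarith :
        _ ≤ -(hamiltonian (φ t) v * (2 * t ^ 2 * (1 - t) ^ 2 * (uniform (S := S)).1 v))))
        (dualArea_pos v).le
      linarith
    -- Completing the square in `√e`.
    have h8 : 25 / 2 * C ^ 2 * A - 10 * (t * (1 - t)) * (C * √e) +
        2 * t ^ 2 * (1 - t) ^ 2 * (√e ^ 2 / A) =
          2 / A * (t * (1 - t) * √e - 5 / 2 * C * A) ^ 2 := by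
      field_simp
      ring
    rw [he] at h8
    have h9 : 0 ≤ 2 / A * (t * (1 - t) * √e - 5 / 2 * C * A) ^ 2 := by positivity
    linarith

/-! ### The axioms of a distance -/

theorem zero_mem_dualValues (μ₀ μ₁ : S.Prob) : 0 ∈ S.dualValues μ₀ μ₁ := by
  refine ⟨fun _ _ => 0, ?_, by simp⟩
  simpa using admissible_test (S := S) (fun _ => 0) (C := 0)
    (fun v => by simpa using (hamiltonian_affine (S := S) (fun _ => 0) 0 0 v).le) 0

theorem isLUB_dualValues (hS : S.E.Connected) (μ₀ μ₁ : S.Prob) :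
    IsLUB (S.dualValues μ₀ μ₁) (S.Wd μ₀ μ₁ ^ 2) := by
  have h0 := zero_mem_dualValues μ₀ μ₁
  have hb := bddAbove_dualValues hS μ₀ μ₁
  rw [Wd, Real.sq_sqrt (le_csSup hb h0)]
  exact isLUB_csSup ⟨0, h0⟩ hb

/-- An admissible potential restricted to a time interval of signed length `l` gains at most
`W_d² / l`. -/
theorem Admissible.mul_integral_sub_le (hS : S.E.Connected) {φ : ℝ → S.V → ℝ}
    (h : S.Admissible φ) {a l : ℝ} (ha : a ∈ Set.Icc (0 : ℝ) 1) (hal : a + l ∈ Set.Icc (0 : ℝ) 1)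
    (μ₀ μ₁ : S.Prob) :
    l * (integral μ₁.1 (φ (a + l)) - integral μ₀.1 (φ a)) ≤ S.Wd μ₀ μ₁ ^ 2 := by
  refine (isLUB_dualValues hS μ₀ μ₁).1 ⟨_, h.rescale ha hal, ?_⟩
  simp only [integral, mul_one, mul_zero, add_zero, mul_sub, Finset.mul_sum]
  congr 1 <;> exact Finset.sum_congr rfl fun v _ => by ring

theorem Wd_self (hS : S.E.Connected) (μ : S.Prob) : S.Wd μ μ = 0 := by
  refine pow_eq_zero_iff two_ne_zero |>.1 (le_antisymm ?_ (sq_nonneg _))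
  refine (isLUB_dualValues hS μ μ).2 ?_
  rintro _ ⟨φ, hφ, rfl⟩
  exact sub_nonpos.2 (integral_mono μ.2.1 hφ.apply_one_le)

theorem eq_of_Wd_eq_zero (hS : S.E.Connected) {μ₀ μ₁ : S.Prob} (h : S.Wd μ₀ μ₁ = 0) :
    μ₀ = μ₁ := by
  refine eq_of_forall_integral_eq fun ψ => ?_
  set C := ∑ v, hamiltonian ψ v
  have hC : ∀ v, hamiltonian ψ v ≤ C := fun v =>
    Finset.single_le_sum (fun v _ => hamiltonian_nonneg ψ v) (Finset.mem_univ v)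
  have hC0 : 0 ≤ C := Finset.sum_nonneg fun v _ => hamiltonian_nonneg ψ v
  have key : ∀ ε : ℝ, ε * (integral μ₁.1 ψ - integral μ₀.1 ψ) ≤ ε ^ 2 * C := fun ε => by
    have h1 := (admissible_test ψ hC ε).mul_integral_sub_le hS (a := 0) (l := 1) (by simp)
      (by simp) μ₀ μ₁
    rw [integral_affine, integral_affine, h] at h1
    linarith
  by_contra! hlt
  -- The maximizer of `ε d - ε² (C + 1)`, for the difference `d` of the two integrals; `C` may be 0.
  have h2 := key ((integral μ₁.1 ψ - integral μ₀.1 ψ) / (2 * (C + 1)))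
  set d := integral μ₁.1 ψ - integral μ₀.1 ψ
  have hd : 0 < d := sub_pos.2 hlt
  rw [div_mul_eq_mul_div, div_pow, div_mul_eq_mul_div, div_le_div_iff₀ (by positivity)
    (by positivity)] at h2
  have h3 : 0 < d ^ 2 * (2 * (C + 1)) := by positivity
  nlinarith

theorem Wd_le_symm (hS : S.E.Connected) (μ₀ μ₁ : S.Prob) : S.Wd μ₀ μ₁ ≤ S.Wd μ₁ μ₀ := by
  refine abs_le_of_sq_le_sq' ?_ (Real.sqrt_nonneg _) |>.2
  refine (isLUB_dualValues hS μ₀ μ₁).2 ?_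
  rintro _ ⟨φ, hφ, rfl⟩
  have := hφ.mul_integral_sub_le hS (a := 1) (l := -1) (by simp) (by simp) μ₁ μ₀
  rw [add_neg_cancel, neg_one_mul, neg_sub] at this
  exact this

theorem Wd_triangle (hS : S.E.Connected) (μ₀ μ₁ μ₂ : S.Prob) :
    S.Wd μ₀ μ₂ ≤ S.Wd μ₀ μ₁ + S.Wd μ₁ μ₂ := by
  have ha : 0 ≤ S.Wd μ₀ μ₁ := Real.sqrt_nonneg _
  have hb : 0 ≤ S.Wd μ₁ μ₂ := Real.sqrt_nonneg _
  rcases ha.eq_or_lt' with ha0 | ha'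
  · rw [ha0, eq_of_Wd_eq_zero hS ha0, zero_add]
  rcases hb.eq_or_lt' with hb0 | hb'
  · rw [hb0, eq_of_Wd_eq_zero hS hb0, add_zero]
  refine abs_le_of_sq_le_sq' ?_ (add_nonneg ha hb) |>.2
  refine (isLUB_dualValues hS μ₀ μ₂).2 ?_
  rintro _ ⟨φ, hφ, rfl⟩
  set a := S.Wd μ₀ μ₁
  set b := S.Wd μ₁ μ₂
  -- A constant-speed curve through `μ₁` is there at the time `a / (a + b)`.
  have hab : a / (a + b) + b / (a + b) = 1 := by field_simp
  have hl : 0 < a / (a + b) := by positivity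
  have hr : 0 < b / (a + b) := by positivity
  have h1 := hφ.mul_integral_sub_le hS (a := 0) (l := a / (a + b)) (by simp)
    ⟨by linarith, by linarith⟩ μ₀ μ₁
  have h2 := hφ.mul_integral_sub_le hS (a := a / (a + b)) (l := b / (a + b))
    ⟨by linarith, by linarith⟩ (by rw [hab]; simp) μ₁ μ₂
  rw [hab] at h2
  rw [zero_add] at h1
  rw [div_mul_eq_mul_div, div_le_iff₀ (by positivity)] at h1 h2
  have h3 : integral μ₁.1 (φ (a / (a + b))) - integral μ₀.1 (φ 0) ≤ a * (a + b) :=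
    le_of_mul_le_mul_left (by linarith) ha'
  have h4 : integral μ₂.1 (φ 1) - integral μ₁.1 (φ (a / (a + b))) ≤ b * (a + b) :=
    le_of_mul_le_mul_left (by linarith) hb'
  change integral μ₂.1 (φ 1) - integral μ₀.1 (φ 0) ≤ (a + b) ^ 2
  linarith

end TriangulatedSurface

theorem proposition2 (S : TriangulatedSurface) (hS : S.E.Connected) :
    (∀ μ₀ μ₁ : S.Prob, IsLUB (S.dualValues μ₀ μ₁) (S.Wd μ₀ μ₁ ^ 2)) ∧
    (∀ μ₀ μ₁ : S.Prob, 0 ≤ S.Wd μ₀ μ₁) ∧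
    (∀ μ₀ μ₁ : S.Prob, S.Wd μ₀ μ₁ = 0 ↔ μ₀ = μ₁) ∧
    (∀ μ₀ μ₁ : S.Prob, S.Wd μ₀ μ₁ = S.Wd μ₁ μ₀) ∧
    (∀ μ₀ μ₁ μ₂ : S.Prob, S.Wd μ₀ μ₂ ≤ S.Wd μ₀ μ₁ + S.Wd μ₁ μ₂) := by
  open TriangulatedSurface in
  exact ⟨isLUB_dualValues hS, fun _ _ => Real.sqrt_nonneg _,
    fun μ₀ μ₁ => ⟨eq_of_Wd_eq_zero hS, fun h => h ▸ Wd_self hS μ₀⟩,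
    fun μ₀ μ₁ => (Wd_le_symm hS μ₀ μ₁).antisymm (Wd_le_symm hS μ₁ μ₀), Wd_triangle hS⟩
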